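/- Let $n$ be the number of Boolean variables. A (deterministic) oblivious leveled branching program has levels $V_0,\dots,V_\ell$ of nodes; all nodes of a level $V_j$, $j<\ell$, test the same variable and each has exactly one outgoing $0$-edge and one outgoing $1$-edge, both leading to $V_{j+1}$; the nodes of $V_\ell$ are sinks. It computes the function that is $1$ exactly on the inputs for which the path consistent with the input leads from a distinguished source $s\in V_0$ to a distinguished sink $t\in V_\ell$. Its width is $\max_{j<\ell}|V_j|$. It is a $k$-OBDD if it consists of $k$ consecutive layers, each of which reads all $n$ variables exactly once, in the same order $\theta$ in all layers. For $k=k(n)$ and a set $C$ of functions $w=w(n)$, $k\text{-OBDD}_C$ is the set of families $(f_n)$ of Boolean functions $f_n:\{0,1\}^n\to\{0,1\}$ for which there is $w\in C$ such that, for all sufficiently large $n$, $f_n$ is computed by a $k(n)$-OBDD of width at most $w(n)$. Let $\mathtt{const}$ be the set of constants $w>20$, $\mathtt{polylog}=\{w: w=O(\log^z n)\text{ for some constant }z\}$, and $\mathtt{sublinear}_\alpha=\{w: w=O(n^\alpha)\}$. Let $k=k(n)$ be a function with values in the nonnegative integers. (1) If $k=o(n/\log n)$ and $\log n=o(k)$,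 then $$\lfloor k/\log_2\log_2 n\rfloor\text{-OBDD}_{\mathtt{const}}\subsetneq k\text{-OBDD}_{\mathtt{const}}.$$ (2) If $\varepsilon,\varepsilon_1>0$, $k=o(n^{1-\varepsilon})$, and $n^{\varepsilon_1}<k$ for all sufficiently large $n$, then $$\lfloor k/n^{\varepsilon_1}\rfloor\text{-OBDD}_{\mathtt{polylog}}\subsetneq k\text{-OBDD}_{\mathtt{polylog}}.$$ (3) If $\varepsilon>0$, $0<\alpha<0.5-\varepsilon$, $k>n^{\alpha}(\log_2 n)^2$ for all sufficiently large $n$, and $k=o(n^{1-\alpha}/\log_2 n)$, then $$\lfloor k/(n^{\alpha}(\log_2 n)^2)\rfloor\text{-OBDD}_{\mathtt{sublinear}_\alpha}\subsetneq k\text{-OBDD}_{\mathtt{sublinear}_\alpha}.$$ -/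

import Mathlib

open Filter Asymptotics

/-- A deterministic oblivious leveled branching program over `n` Boolean variables.  Its levels are
indexed by `0, …, length`; level `j` has `size j` nodes.  All (inner) nodes of a level `j < length`
are labeled by the same variable `var j`, and each of them has exactly two outgoing edges, labeled
by the two possible values of that variable, both leading to the next level.  The nodes of the
last level are the sink nodes.  `source` and `sink` are the distinguished nodes `s` and `t`. -/
structure ObliviousBP (n : ℕ) where
  length : ℕ
  size : Fin (length + 1) → ℕ
  var : Fin length → Fin n
  next : (j : Fin length) → Fin (size j.castSucc) → Bool → Fin (size j.succ)
  source : Fin (size 0)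
  sink : Fin (size (Fin.last length))

namespace ObliviousBP

variable {n : ℕ}

/-- There is a path from the source to the sink all of whose edges are consistent with `x`. -/
def Accepts (P : ObliviousBP n) (x : Fin n → Bool) : Prop :=
  ∃ p : (j : Fin (P.length + 1)) → Fin (P.size j),
    p 0 = P.source ∧ p (Fin.last P.length) = P.sink ∧
      ∀ j : Fin P.length, p j.succ = P.next j (p j.castSucc) (x (P.var j))

/-- `P` computes the Boolean function `f`. -/
def Computes (P : ObliviousBP n) (f : (Fin n → Bool) → Bool) : Prop :=
  ∀ x, f x = true ↔ P.Accepts x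

/-- The width: the maximal number of nodes in a level (the level of the sinks is not counted). -/
def width (P : ObliviousBP n) : ℕ :=
  Finset.univ.sup fun j : Fin P.length => P.size j.castSucc

/-- `P` is a `k`-OBDD: it consists of `k` consecutive layers, each of which reads every variable
exactly once, in one and the same order `θ`. -/
def IsKOBDD (k : ℕ) (P : ObliviousBP n) : Prop :=
  ∃ θ : Equiv.Perm (Fin n), P.length = k * n ∧
    ∀ (j : Fin P.length) (i : Fin n), (j : ℕ) % n = i → P.var j = θ i

end ObliviousBP

/-- A Boolean function for every number `n` of variables. -/
abbrev BoolFamily : Type := (n : ℕ) → (Fin n → Bool) → Bool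

/-- The class `k-OBDD_C` for `k = k(n)` and a set `C` of width bounds `w = w(n)`: the families
that, for some `w ∈ C` and all sufficiently large `n`, are computed by `k(n)`-OBDDs of width at
most `w(n)`. -/
def kOBDDClass (k : ℕ → ℕ) (C : Set (ℕ → ℕ)) : Set BoolFamily :=
  {f | ∃ w ∈ C, ∀ᶠ n in atTop,
    ∃ P : ObliviousBP n, P.IsKOBDD (k n) ∧ P.width ≤ w n ∧ P.Computes (f n)}

/-- Constant width (with a constant greater than 20). -/
def constWidth : Set (ℕ → ℕ) :=
  {w | ∃ c : ℕ, 20 < c ∧ ∀ n, w n = c}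

/-- Polylogarithmic width: `w = O(log^z n)` for some constant `z`. -/
def polylogWidth : Set (ℕ → ℕ) :=
  {w | ∃ z : ℕ, (fun n => (w n : ℝ)) =O[atTop] fun n : ℕ => Real.logb 2 n ^ z}

/-- Sublinear width: `w = O(n^α)`. -/
def sublinearWidth (α : ℝ) : Set (ℕ → ℕ) :=
  {w | (fun n => (w n : ℝ)) =O[atTop] fun n : ℕ => (n : ℝ) ^ α}

/-! The proof counts functions. A width-`w` program with `k'` layers is an order, `k' * n`
transition tables and a start state, so `log₂` of the number of computed functions is at most about
`n log n + 2 w k' n log w` (`ncard_kOBDDFunctions_le`). Conversely, width 4 and `k` layers compute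
every form `∑ A i p * x i * x p` over `𝔽₂` with `i < k ≤ p`, one row `i` per layer, giving `2 ^ ((n
- k) * k)` functions. If `k ≤ n / 2`, `k` dominates `log n` and `k'` is smaller than `k` by a factor
`D` of order `w log w`, the second count wins (`factorial_mul_pow_lt_two_pow`). In each case a
single width `W n` eventually exceeds every width of the class and still satisfies `16 W log W ≤ D`,
so one family escapes all of them (`kOBDDClass_floor_ssubset`). -/

/-! ### Programs as state machines with a fixed state set. -/

/-- The state reached after `j` steps by a machine that reads the variables cyclically in the
order `θ` and changes its state according to `T`, starting from `s`. -/
def leveledRun {n : ℕ} [NeZero n] {S : Type*} (θ : Equiv.Perm (Fin n)) (T : ℕ → S → Bool → S)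
    (s : S) (x : Fin n → Bool) : ℕ → S
  | 0 => s
  | j + 1 => T j (leveledRun θ T s x j) (x (θ (Fin.ofNat n j)))

theorem leveledRun_congr {n : ℕ} [NeZero n] {S : Type*} (θ : Equiv.Perm (Fin n))
    {T T' : ℕ → S → Bool → S} (s : S) (x : Fin n → Bool) {L : ℕ} (h : ∀ j < L, T j = T' j) :
    ∀ j ≤ L, leveledRun θ T s x j = leveledRun θ T' s x j
  | 0, _ => rfl
  | j + 1, hj => by
    simp only [leveledRun]
    rw [leveledRun_congr θ s x h j (by omega), h j (by omega)]

theorem leveledRun_add_of_id {n : ℕ} [NeZero n] {S : Type*} (θ : Equiv.Perm (Fin n))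
    {T : ℕ → S → Bool → S} (s : S) (x : Fin n → Bool) {L : ℕ} (h : ∀ j ≥ L, ∀ u b, T j u b = u) :
    ∀ d, leveledRun θ T s x (L + d) = leveledRun θ T s x L
  | 0 => rfl
  | d + 1 => by
    rw [← add_assoc, leveledRun, h _ (by omega), leveledRun_add_of_id θ s x h d]

theorem exists_program_of_leveledRun {n : ℕ} [NeZero n] {S : Type*} [Fintype S] (k : ℕ)
    (θ : Equiv.Perm (Fin n)) (T : ℕ → S → Bool → S) (s t : S) :
    ∃ P : ObliviousBP n, P.IsKOBDD k ∧ P.width ≤ Fintype.card S ∧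
      ∀ x, P.Accepts x ↔ leveledRun θ T s x (k * n) = t := by
  let e := Fintype.equivFin S
  refine ⟨⟨k * n, fun _ => Fintype.card S, fun j => θ (Fin.ofNat n j),
    fun j u b => e (T j (e.symm u) b), e s, e t⟩, ⟨θ, rfl, ?_⟩, ?_, ?_⟩
  · intro j i hij
    exact congrArg θ (Fin.ext hij)
  · exact Finset.sup_le fun _ _ => le_rfl
  · intro x
    constructor
    · rintro ⟨p, h0, h1, h2⟩
      have key : ∀ j (hj : j < k * n + 1), p ⟨j, hj⟩ = e (leveledRun θ T s x j) := by
        intro j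
        induction j with
        | zero => intro _; exact h0
        | succ j ih =>
          intro hj
          have := h2 ⟨j, by simpa using hj⟩
          refine this.trans ?_
          have h3 := ih (by omega)
          simp only [Fin.castSucc_mk, leveledRun]
          rw [h3, e.symm_apply_apply]
      exact e.injective ((key (k * n) (by omega)).symm.trans h1)
    · intro h
      refine ⟨fun j => e (leveledRun θ T s x j), rfl, congrArg e h, fun j => ?_⟩
      simp [leveledRun]

/-- Inner levels embed in `Fin w`. The width does not bound the sink level, so that level is
collapsed to two states, 1 for the sink and 0 for the rest; hence `2 ≤ w`. -/
theorem ObliviousBP.IsKOBDD.exists_leveledRun {n : ℕ} [NeZero n] {k w : ℕ} {P : ObliviousBP n}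
    (hP : P.IsKOBDD k) (hw : P.width ≤ w) (h2 : 2 ≤ w) :
    ∃ (θ : Equiv.Perm (Fin n)) (T : ℕ → Fin w → Bool → Fin w) (s : Fin w),
      ∀ x, P.Accepts x ↔ leveledRun θ T s x (k * n) = ⟨1, h2⟩ := by
  obtain ⟨θ, hlen, hvar⟩ := hP
  have hsize : ∀ j : Fin (P.length + 1), j ≠ Fin.last _ → P.size j ≤ w := by
    intro j hj
    obtain ⟨i, rfl⟩ := Fin.exists_castSucc_eq.2 hj
    exact le_trans (Finset.le_sup (f := fun j : Fin P.length => P.size j.castSucc)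
      (Finset.mem_univ i)) hw
  let e : (j : Fin (P.length + 1)) → Fin (P.size j) → Fin w := fun j u =>
    if h : j = Fin.last _ then (if h ▸ u = P.sink then ⟨1, h2⟩ else ⟨0, by omega⟩)
    else Fin.castLE (hsize j h) u
  have he : ∀ u, e (Fin.last _) u = ⟨1, h2⟩ ↔ u = P.sink := by
    intro u
    by_cases hu : u = P.sink <;> simp [e, hu]
  let T : ℕ → Fin w → Bool → Fin w := fun j u b =>
    if h : ∃ hj : j < P.length, u.val < P.size (Fin.castSucc ⟨j, hj⟩) then
      e _ (P.next ⟨j, h.1⟩ ⟨u, h.2⟩ b) else u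
  have hT : ∀ (j : Fin P.length) (u : Fin (P.size j.castSucc)) b,
      T j (e _ u) b = e _ (P.next j u b) := by
    intro j u b
    have h1 : e j.castSucc u = Fin.castLE (hsize _ (Fin.castSucc_lt_last j).ne) u := by
      simp [e, (Fin.castSucc_lt_last j).ne]
    have h3 : ∃ hj : (j : ℕ) < P.length, u.val < P.size (Fin.castSucc ⟨j, hj⟩) := ⟨j.2, u.2⟩
    rw [h1]
    simp only [T, Fin.val_castLE, Fin.eta, dif_pos h3]
  refine ⟨θ, T, e 0 P.source, fun x => ?_⟩
  let p : (j : Fin (P.length + 1)) → Fin (P.size j) :=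
    Fin.induction P.source fun j u => P.next j u (x (P.var j))
  have hps : ∀ j : Fin P.length, p j.succ = P.next j (p j.castSucc) (x (P.var j)) := fun j =>
    Fin.induction_succ _ _ _
  have hrun : ∀ j : Fin (P.length + 1), e j (p j) = leveledRun θ T (e 0 P.source) x j := by
    intro j
    induction j using Fin.induction with
    | zero => rfl
    | succ j ih =>
      rw [hps, ← hT, ih, hvar j (Fin.ofNat n j) rfl]
      rfl
  have hlast : leveledRun θ T (e 0 P.source) x (k * n) = e _ (p (Fin.last _)) := by
    rw [hrun, Fin.val_last]
    exact congrArg _ hlen.symm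
  rw [hlast, he]
  constructor
  · rintro ⟨q, h0, h1, h3⟩
    have : ∀ j, q j = p j := by
      intro j
      induction j using Fin.induction with
      | zero => exact h0
      | succ j ih => rw [h3, hps, ih]
    exact (this _).symm.trans h1
  · exact fun h => ⟨p, rfl, h, hps⟩

/-! ### Upper bound on the number of computed functions. -/

/-- The Boolean functions computed by `k`-OBDDs of width at most `w`. -/
def kOBDDFunctions (n k w : ℕ) : Set ((Fin n → Bool) → Bool) :=
  {f | ∃ P : ObliviousBP n, P.IsKOBDD k ∧ P.width ≤ w ∧ P.Computes f}

/-- Surplus layers leave the state unchanged. -/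
theorem kOBDDFunctions_mono {n k k' w w' : ℕ} [NeZero n] (hk : k ≤ k') (hw : w ≤ w')
    (h2 : 2 ≤ w') : kOBDDFunctions n k w ⊆ kOBDDFunctions n k' w' := by
  rintro f ⟨P, hP, hPw, hf⟩
  obtain ⟨θ, T, s, h⟩ := hP.exists_leveledRun (hPw.trans hw) h2
  obtain ⟨Q, hQ, hQw, hQf⟩ := exists_program_of_leveledRun k' θ
    (fun j u b => if j < k * n then T j u b else u) s ⟨1, h2⟩
  refine ⟨Q, hQ, by simpa using hQw, fun x => ?_⟩
  obtain ⟨d, hd⟩ := Nat.exists_eq_add_of_le (Nat.mul_le_mul_right n hk)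
  rw [hf, h, hQf, hd, leveledRun_add_of_id θ s x (L := k * n)]
  · rw [leveledRun_congr θ s x (T' := fun j u b => if j < k * n then T j u b else u)
      (L := k * n) _ _ le_rfl]
    intro j hj
    simp [hj]
  · intro j hj u b
    simp [not_lt.2 hj]

theorem ncard_kOBDDFunctions_le {n k w : ℕ} [NeZero n] (h2 : 2 ≤ w) :
    (kOBDDFunctions n k w).ncard ≤ n.factorial * (((w ^ 2) ^ w) ^ (k * n) * w) := by
  classical
  let g : Equiv.Perm (Fin n) × (Fin (k * n) → Fin w → Bool → Fin w) × Fin w →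
      ((Fin n → Bool) → Bool) := fun a x =>
    decide (leveledRun a.1 (fun j u b => if h : j < k * n then a.2.1 ⟨j, h⟩ u b else u)
      a.2.2 x (k * n) = ⟨1, h2⟩)
  have hsub : kOBDDFunctions n k w ⊆ Set.range g := by
    rintro f ⟨P, hP, hPw, hf⟩
    obtain ⟨θ, T, s, h⟩ := hP.exists_leveledRun hPw h2
    refine ⟨⟨θ, fun j => T j, s⟩, funext fun x => ?_⟩
    rw [Bool.eq_iff_iff, hf, h]
    simp only [g, decide_eq_true_eq]
    rw [leveledRun_congr θ s x (T' := T) (L := k * n) _ _ le_rfl]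
    intro j hj
    simp [hj]
  calc (kOBDDFunctions n k w).ncard ≤ (Set.range g).ncard :=
        Set.ncard_le_ncard hsub (Set.finite_range g)
    _ ≤ Nat.card (Equiv.Perm (Fin n) × (Fin (k * n) → Fin w → Bool → Fin w) × Fin w) := by
        rw [← Set.image_univ, ← Set.ncard_univ]
        exact Set.ncard_image_le Set.finite_univ
    _ = _ := by simp [Nat.card_eq_fintype_card, Fintype.card_perm]

/-! ### Lower bound: bilinear forms in width 4. -/

/-- In pass `i` over the variables, remember `x i` and, if it is set, add `∑ A i p * x p` over the
variables `p ≥ k` to the result.  The state consists of the remembered bit and the result. -/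
def bilinearStep (n k : ℕ) (A : ℕ → ℕ → Bool) (j : ℕ) (u : Bool × Bool) (b : Bool) :
    Bool × Bool :=
  (if j % n = j / n then b else if j % n + 1 = n then false else u.1,
    if k ≤ j % n ∧ u.1 ∧ A (j / n) (j % n) ∧ b then !u.2 else u.2)

theorem succ_div_mod_of_mod_ne_zero {n j : ℕ} (h : (j + 1) % n ≠ 0) :
    (j + 1) / n = j / n ∧ (j + 1) % n = j % n + 1 := by
  have h1 : (j + 1) / n = j / n := by
    rw [Nat.succ_div, if_neg fun hd => h (Nat.mod_eq_zero_of_dvd hd), add_zero]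
  refine ⟨h1, ?_⟩
  have := Nat.div_add_mod j n
  have h3 := Nat.div_add_mod (j + 1) n
  rw [h1] at h3
  omega

/-- An input supported on `{i, p}` reads off the single coefficient `A i p`, so distinct matrices
give distinct functions. -/
theorem leveledRun_bilinearStep {n k : ℕ} [NeZero n] (A : ℕ → ℕ → Bool)
    {i p : ℕ} (hi : i < k) (hkp : k ≤ p) (hp : p < n) :
    leveledRun (Equiv.refl (Fin n)) (bilinearStep n k A) (false, false)
      (fun v => decide (v.val = i ∨ v.val = p)) (k * n) = (false, A i p) := by
  have hn : 0 < n := by omega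
  -- Invariants: the bit is clear when a pass starts; once pass `j / n` has read its own variable,
  -- the bit is set only in pass `i`, as `j / n < k ≤ p`; the result can flip only at time `i * n +
  -- p`.
  have key : ∀ j ≤ k * n, ∀ u, leveledRun (Equiv.refl (Fin n)) (bilinearStep n k A) (false, false)
      (fun v : Fin n => decide (v.val = i ∨ v.val = p)) j = u →
      (j % n = 0 → u.1 = false) ∧ (j / n < j % n → (u.1 = true ↔ j / n = i)) ∧
      u.2 = (decide (i * n + p < j) && A i p) := by
    intro j
    induction j with
    | zero =>
      rintro - u rfl
      simp [leveledRun]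
    | succ j ih =>
      intro hj u hu
      obtain ⟨h1, h2, h3⟩ := ih (by omega) _ rfl
      have hdiv : j / n < k := Nat.div_lt_of_lt_mul (by rw [mul_comm]; omega)
      simp only [leveledRun, Equiv.refl_apply, Fin.val_ofNat] at hu
      generalize leveledRun (Equiv.refl (Fin n)) (bilinearStep n k A) (false, false)
        (fun v : Fin n => decide (v.val = i ∨ v.val = p)) j = u' at hu h1 h2 h3
      subst hu
      have hjd := Nat.div_add_mod j n
      have hmod := Nat.mod_lt j hn
      refine ⟨fun h0 => ?_, fun hlt => ?_, ?_⟩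
      · have hlast : j % n + 1 = n := by
          have hd := Nat.dvd_of_mod_eq_zero h0
          have : n ∣ j % n + 1 := by
            rw [← hjd, add_assoc] at hd
            exact (Nat.dvd_add_right (Dvd.intro _ rfl)).1 hd
          exact le_antisymm (by omega) (Nat.le_of_dvd (by omega) this)
        have : j % n ≠ j / n := by omega
        simp [bilinearStep, this, hlast]
      · obtain ⟨e1, e2⟩ := succ_div_mod_of_mod_ne_zero
          (Nat.ne_of_gt ((Nat.zero_le _).trans_lt hlt))
        have hlt' := Nat.mod_lt (j + 1) hn
        rw [e1]
        by_cases hq : j % n = j / n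
        · simp only [bilinearStep, hq, if_true, decide_eq_true_eq]
          omega
        · have : j % n + 1 ≠ n := by omega
          simp only [bilinearStep, if_neg hq, if_neg this]
          exact h2 (by omega)
      · have hiff : j = i * n + p ↔ j / n = i ∧ j % n = p := by
          constructor
          · rintro rfl
            rw [mul_comm, Nat.mul_add_div hn, Nat.mul_add_mod, Nat.div_eq_of_lt hp,
              Nat.mod_eq_of_lt hp]
            simp
          · rintro ⟨rfl, rfl⟩
            rw [mul_comm]; exact hjd.symm
        by_cases hkm : k ≤ j % n
        · have h2' := h2 (by omega)
          by_cases hji : j = i * n + p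
          · obtain ⟨a, b⟩ := hiff.1 hji
            have hu1 : u'.1 = true := h2'.2 a
            have hf : u'.2 = false := by rw [h3]; simp [hji]
            have hlt : i * n + p < j + 1 := by omega
            simp only [bilinearStep, a, b, hu1, hf, hlt]
            cases A i p <;> simp [hkp]
          · have : ¬ (u'.1 = true ∧ (j % n = i ∨ j % n = p)) := by
              rintro ⟨c, d⟩
              exact hji (hiff.2 ⟨h2'.1 c, by omega⟩)
            have hd : decide (i * n + p < j + 1) = decide (i * n + p < j) := by
              apply decide_eq_decide.2; omega
            rw [hd, ← h3]
            simp only [bilinearStep]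
            rw [if_neg]
            rintro ⟨-, c, -, d⟩
            exact this ⟨c, of_decide_eq_true d⟩
        · have hne : j ≠ i * n + p := fun h => by have := (hiff.1 h).2; omega
          have hd : decide (i * n + p < j + 1) = decide (i * n + p < j) := by
            apply decide_eq_decide.2; omega
          rw [hd, ← h3]
          simp [bilinearStep, hkm]
  obtain ⟨h1, -, h3⟩ := key (k * n) le_rfl _ rfl
  have hlt : i * n + p < k * n := by nlinarith
  refine Prod.ext (h1 (by simp)) (h3.trans ?_)
  simp [hlt]

theorem two_pow_le_ncard_kOBDDFunctions (n k : ℕ) [NeZero n] :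
    2 ^ ((n - k) * k) ≤ (kOBDDFunctions n k 4).ncard := by
  classical
  let ext : (Fin k → Fin (n - k) → Bool) → ℕ → ℕ → Bool := fun A i p =>
    if h : i < k ∧ p - k < n - k then A ⟨i, h.1⟩ ⟨p - k, h.2⟩ else false
  let F : (Fin k → Fin (n - k) → Bool) → (Fin n → Bool) → Bool := fun A x =>
    decide (leveledRun (Equiv.refl (Fin n)) (bilinearStep n k (ext A)) (false, false) x (k * n) =
      (false, true))
  have hinj : Function.Injective F := by
    intro A B hAB
    funext i p
    have h := congrFun hAB fun v => decide (v.val = i.val ∨ v.val = k + p.val)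
    have hp := p.2
    simp only [F] at h
    rw [leveledRun_bilinearStep _ i.2 (by omega) (by omega),
      leveledRun_bilinearStep _ i.2 (by omega) (by omega)] at h
    simpa [ext] using h
  have hsub : Set.range F ⊆ kOBDDFunctions n k 4 := by
    rintro _ ⟨A, rfl⟩
    obtain ⟨P, hP, hw, h⟩ := exists_program_of_leveledRun k (Equiv.refl (Fin n))
      (bilinearStep n k (ext A)) (false, false) (false, true)
    refine ⟨P, hP, by simpa using hw, fun x => ?_⟩
    rw [h]
    simp [F]
  calc 2 ^ ((n - k) * k) = (Set.range F).ncard := by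
        rw [← Set.image_univ, Set.ncard_image_of_injective _ hinj, Set.ncard_univ]
        simp [Nat.card_eq_fintype_card, pow_mul]
    _ ≤ _ := Set.ncard_le_ncard hsub (Set.toFinite _)

/-! ### Separation by comparing the counts. -/

theorem exists_mem_kOBDDFunctions_notMem {n k k' w : ℕ} [NeZero n] (h2 : 2 ≤ w)
    (h : n.factorial * (((w ^ 2) ^ w) ^ (k' * n) * w) < 2 ^ ((n - k) * k)) :
    ∃ f ∈ kOBDDFunctions n k 4, f ∉ kOBDDFunctions n k' w := by
  by_contra! hc
  exact absurd (Set.ncard_le_ncard hc (Set.toFinite _)) (not_le.2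
    ((ncard_kOBDDFunctions_le h2).trans_lt (h.trans_le (two_pow_le_ncard_kOBDDFunctions n k))))

/-- In exponents of 2, the orders cost at most `k n / 8`, the tables `k n / 8` and the start state
`D / 16 ≤ k n / 16`; the total stays below `k n / 2 ≤ (n - k) k`. -/
theorem factorial_mul_pow_lt_two_pow {n k k' w : ℕ} {D : ℝ} (hn : 0 < n) (hw : 0 < w) (hk0 : 0 < k)
    (hk : 2 * k ≤ n) (hlog : 8 * Real.logb 2 n ≤ k) (hk' : k' * D ≤ k)
    (hwD : 16 * (w * Real.logb 2 w) ≤ D) (hD : D ≤ k * n) :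
    n.factorial * (((w ^ 2) ^ w) ^ (k' * n) * w) < 2 ^ ((n - k) * k) := by
  have hn' : (0 : ℝ) < n := by exact_mod_cast hn
  have hk0' : (0 : ℝ) < k := by exact_mod_cast hk0
  have hkn : (2 : ℝ) * k ≤ n := by exact_mod_cast hk
  have hw1 : (1 : ℝ) ≤ w := by exact_mod_cast hw
  have hlw : 0 ≤ Real.logb 2 w := Real.logb_nonneg one_lt_two hw1
  have hpow : ∀ m e : ℕ, 0 < m → (m : ℝ) ^ e = (2 : ℝ) ^ (Real.logb 2 m * e) := by
    intro m e hm
    rw [Real.rpow_mul two_pos.le, Real.rpow_logb two_pos (by norm_num) (by exact_mod_cast hm),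
      Real.rpow_natCast]
  have hcount : n.factorial * (((w ^ 2) ^ w) ^ (k' * n) * w) ≤
      n ^ n * w ^ (2 * w * (k' * n) + 1) := by
    rw [← pow_mul, ← pow_mul, ← pow_succ, ← mul_assoc 2 w]
    exact Nat.mul_le_mul_right _ (Nat.factorial_le_pow n)
  refine hcount.trans_lt ?_
  rw [← Nat.cast_lt (α := ℝ)]
  push_cast
  rw [hpow n n hn, hpow w _ hw, ← Real.rpow_add two_pos, ← Real.rpow_natCast 2]
  apply Real.rpow_lt_rpow_of_exponent_lt one_lt_two
  rw [Nat.cast_mul, Nat.cast_sub (by omega)]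
  push_cast
  have h1 : Real.logb 2 n * n ≤ k * n / 8 := by nlinarith
  have h2 : (k' * n : ℝ) * (16 * (w * Real.logb 2 w)) ≤ k * n :=
    calc (k' * n : ℝ) * (16 * (w * Real.logb 2 w)) ≤ (k' * n : ℝ) * D := by gcongr
      _ = (k' * D) * n := by ring
      _ ≤ k * n := by gcongr
  have h3 : Real.logb 2 w ≤ w * Real.logb 2 w := le_mul_of_one_le_left hlw hw1
  have h4 : (k * n : ℝ) / 2 ≤ (n - k) * k := by nlinarith
  have h5 : (0 : ℝ) < k * n := by positivity
  nlinarith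

/-- If few passes with width in `C` are beaten by counting, they define a smaller class. -/
theorem kOBDDClass_floor_ssubset {k : ℕ → ℕ} {C : Set (ℕ → ℕ)} (W : ℕ → ℕ) (D : ℕ → ℝ)
    (hC2 : ∀ w ∈ C, ∃ w' ∈ C, ∀ n, w n ≤ w' n ∧ 2 ≤ w' n) (hC4 : ∃ w ∈ C, ∀ n, 4 ≤ w n)
    (hCW : ∀ w ∈ C, ∀ᶠ n in atTop, w n ≤ W n)
    (hlog : ∀ᶠ n : ℕ in atTop, 8 * Real.logb 2 n ≤ k n) (hk : ∀ᶠ n in atTop, 2 * k n ≤ n)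
    (hD1 : ∀ᶠ n in atTop, 1 ≤ D n) (hDk : ∀ᶠ n in atTop, D n ≤ k n)
    (hWD : ∀ᶠ n in atTop, 16 * (W n * Real.logb 2 (W n)) ≤ D n) :
    kOBDDClass (fun n => ⌊(k n : ℝ) / D n⌋₊) C ⊂ kOBDDClass k C := by
  classical
  obtain ⟨w₄, hw₄C, hw₄⟩ := hC4
  refine ⟨?_, ?_⟩
  · rintro f ⟨w, hw, hf⟩
    obtain ⟨w', hw', h⟩ := hC2 w hw
    refine ⟨w', hw', ?_⟩
    filter_upwards [hf, hD1, eventually_gt_atTop 0] with n hfn h1 hn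
    have : NeZero n := ⟨hn.ne'⟩
    refine kOBDDFunctions_mono (Nat.floor_le_of_le ?_) (h n).1 (h n).2 hfn
    exact div_le_self (Nat.cast_nonneg _) h1
  · intro hsub
    -- Escaping width `W n`, rather than one given `w`, makes the family independent of `w ∈ C`.
    let Sep : (n : ℕ) → ((Fin n → Bool) → Bool) → Prop := fun n f =>
      f ∈ kOBDDFunctions n (k n) 4 ∧ f ∉ kOBDDFunctions n ⌊(k n : ℝ) / D n⌋₊ (W n)
    let F : BoolFamily := fun n => if h : ∃ f, Sep n f then h.choose else fun _ => false
    have hF : ∀ᶠ n in atTop, 4 ≤ W n ∧ Sep n (F n) := by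
      filter_upwards [hCW w₄ hw₄C, hlog, hk, hD1, hDk, hWD, eventually_gt_atTop 1]
        with n h4 hlog hk hD1 hDk hWD hn
      have : NeZero n := ⟨by omega⟩
      have hn' : (1 : ℝ) < n := by exact_mod_cast hn
      have h4' : 4 ≤ W n := (hw₄ n).trans h4
      have hk0 : 0 < k n := by
        rw [← Nat.cast_pos (α := ℝ)]
        linarith
      have hlt := factorial_mul_pow_lt_two_pow (k' := ⌊(k n : ℝ) / D n⌋₊) (by omega) (by omega)
        hk0 hk hlog
        ((le_div_iff₀ (by linarith)).1 (Nat.floor_le (div_nonneg (Nat.cast_nonneg _) (by linarith))))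
        hWD (hDk.trans (le_mul_of_one_le_right (Nat.cast_nonneg _) hn'.le))
      have hex : ∃ f, Sep n f := exists_mem_kOBDDFunctions_notMem (by omega) hlt
      refine ⟨h4', ?_⟩
      simp only [F, dif_pos hex]
      exact hex.choose_spec
    have hmem : F ∈ kOBDDClass k C := by
      refine ⟨w₄, hw₄C, ?_⟩
      filter_upwards [hF, eventually_gt_atTop 0] with n h hn
      have : NeZero n := ⟨hn.ne'⟩
      exact kOBDDFunctions_mono le_rfl (hw₄ n) (by have := hw₄ n; omega) h.2.1
    obtain ⟨w, hw, hFw⟩ := hsub hmem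
    obtain ⟨n, hn, h, hle, hn0⟩ :=
      (hFw.and (hF.and ((hCW w hw).and (eventually_gt_atTop 0)))).exists
    have : NeZero n := ⟨hn0.ne'⟩
    exact h.2.2 (kOBDDFunctions_mono le_rfl hle (by omega) hn)

/-! ### Asymptotic estimates. -/

theorem tendsto_logb_two_natCast_atTop :
    Tendsto (fun n : ℕ => Real.logb 2 n) atTop atTop :=
  (Real.tendsto_logb_atTop one_lt_two).comp tendsto_natCast_atTop_atTop

theorem logb_two_pow_isLittleO_rpow (z : ℕ) {r : ℝ} (hr : 0 < r) :
    (fun n : ℕ => Real.logb 2 n ^ z) =o[atTop] fun n : ℕ => (n : ℝ) ^ r := by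
  have h := (isLittleO_log_rpow_rpow_atTop (z : ℝ) hr).comp_tendsto
    (tendsto_natCast_atTop_atTop (R := ℝ))
  have h2 := h.const_mul_left ((Real.log 2 ^ z)⁻¹)
  refine h2.congr_left fun n => ?_
  simp [Real.logb, div_eq_inv_mul, mul_pow]

theorem logb_two_natCast_le_self (m : ℕ) : Real.logb 2 m ≤ m := by
  rcases Nat.eq_zero_or_pos m with rfl | hm
  · simp
  · rw [Real.logb_le_iff_le_rpow one_lt_two (by exact_mod_cast hm), Real.rpow_natCast]
    exact_mod_cast Nat.lt_two_pow_self.le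

/-- The crude bound `log₂ m ≤ m` gives `16 m log₂ m ≤ (4 m)²`, which suffices when the widths are
eventually below `√D / 4`. -/
theorem mul_logb_floor_sqrt_le {D : ℝ} (hD : 0 ≤ D) :
    16 * ((⌊√D / 4⌋₊ : ℝ) * Real.logb 2 ⌊√D / 4⌋₊) ≤ D := by
  have h1 : (⌊√D / 4⌋₊ : ℝ) ≤ √D / 4 := Nat.floor_le (by positivity)
  have h2 := mul_le_mul_of_nonneg_left (logb_two_natCast_le_self ⌊√D / 4⌋₊)
    (Nat.cast_nonneg (α := ℝ) ⌊√D / 4⌋₊)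
  have h3 := Real.sq_sqrt hD
  have h4 : (0 : ℝ) ≤ (⌊√D / 4⌋₊ : ℝ) := Nat.cast_nonneg _
  nlinarith

theorem two_mul_le_of_isLittleO {k : ℕ → ℕ} {g : ℕ → ℝ}
    (h : (fun n => (k n : ℝ)) =o[atTop] g) (hg : ∀ᶠ n : ℕ in atTop, |g n| ≤ n) :
    ∀ᶠ n in atTop, 2 * k n ≤ n := by
  filter_upwards [h.def (c := 1 / 2) (by norm_num), hg] with n h1 h2
  rw [Real.norm_eq_abs, Real.norm_eq_abs, Nat.abs_cast] at h1
  have : (2 : ℝ) * k n ≤ n := by linarith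
  exact_mod_cast this

theorem natCast_add_const_isBigO {w : ℕ → ℕ} {g : ℕ → ℝ} (h : (fun n => (w n : ℝ)) =O[atTop] g)
    (hg : ∀ᶠ n in atTop, 1 ≤ g n) (c : ℕ) :
    (fun n => ((w n + c : ℕ) : ℝ)) =O[atTop] g := by
  have hc : (fun _ : ℕ => (c : ℝ)) =O[atTop] g := by
    refine IsBigO.of_bound c ?_
    filter_upwards [hg] with n hn
    rw [Real.norm_eq_abs, Real.norm_eq_abs, Nat.abs_cast]
    exact le_mul_of_one_le_right (Nat.cast_nonneg _) (hn.trans (le_abs_self _))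
  simpa using h.add hc

theorem eventually_one_le_logb_pow (z : ℕ) : ∀ᶠ n : ℕ in atTop, 1 ≤ Real.logb 2 n ^ z := by
  filter_upwards [tendsto_logb_two_natCast_atTop.eventually_ge_atTop 1] with n hn
  exact one_le_pow₀ hn

theorem eventually_one_le_rpow {r : ℝ} (hr : 0 ≤ r) : ∀ᶠ n : ℕ in atTop, 1 ≤ (n : ℝ) ^ r := by
  filter_upwards [eventually_ge_atTop 1] with n hn
  exact Real.one_le_rpow (by exact_mod_cast hn) hr

/-! ### The three width classes. -/

theorem const_kOBDDClass_ssubset (k : ℕ → ℕ)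
    (hk : (fun n => (k n : ℝ)) =o[atTop] (fun n : ℕ => (n : ℝ) / Real.logb 2 n))
    (hlog : (fun n : ℕ => Real.logb 2 n) =o[atTop] (fun n => (k n : ℝ))) :
    kOBDDClass (fun n => ⌊(k n : ℝ) / Real.logb 2 (Real.logb 2 n)⌋₊) constWidth
      ⊂ kOBDDClass k constWidth := by
  have hL := tendsto_logb_two_natCast_atTop
  have hD : Tendsto (fun n : ℕ => Real.logb 2 (Real.logb 2 n)) atTop atTop :=
    (Real.tendsto_logb_atTop one_lt_two).comp hL
  have hlog8 : ∀ᶠ n : ℕ in atTop, 8 * Real.logb 2 n ≤ k n := by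
    filter_upwards [hlog.def (c := 1 / 8) (by norm_num)] with n h1
    rw [Real.norm_eq_abs, Real.norm_eq_abs, Nat.abs_cast] at h1
    linarith [le_abs_self (Real.logb 2 (n : ℝ))]
  refine kOBDDClass_floor_ssubset (fun n => ⌊√(Real.logb 2 (Real.logb 2 n)) / 4⌋₊) _
    ?_ ?_ ?_ hlog8 ?_ (hD.eventually_ge_atTop 1) ?_ ?_
  · rintro w ⟨c, hc, hw⟩
    exact ⟨w, ⟨c, hc, hw⟩, fun n => ⟨le_rfl, by rw [hw]; omega⟩⟩
  · exact ⟨fun _ => 21, ⟨21, by norm_num, fun _ => rfl⟩, fun _ => by norm_num⟩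
  · rintro w ⟨c, -, hw⟩
    filter_upwards [(Real.tendsto_sqrt_atTop.comp hD).eventually_ge_atTop (4 * c : ℝ)] with n hn
    rw [hw]
    exact Nat.le_floor (by simp only [Function.comp] at hn; linarith)
  · refine two_mul_le_of_isLittleO hk ?_
    filter_upwards [hL.eventually_ge_atTop 1] with n hn
    rw [abs_of_nonneg (by positivity)]
    exact div_le_self (Nat.cast_nonneg _) hn
  · filter_upwards [hlog8, hL.eventually_ge_atTop 1] with n h1 h2
    have : Real.logb 2 (Real.logb 2 n) ≤ Real.logb 2 n := by
      rw [Real.logb_le_iff_le_rpow one_lt_two (by linarith)]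
      -- Bernoulli's inequality gives `1 + L ≤ 2 ^ L` for `L = log₂ n`.
      have := one_add_mul_self_le_rpow_one_add (s := 1) (by norm_num) h2
      norm_num at this
      linarith
    linarith
  · filter_upwards [hD.eventually_ge_atTop 0] with n hn
    exact mul_logb_floor_sqrt_le hn

theorem polylog_kOBDDClass_ssubset (ε ε₁ : ℝ) (k : ℕ → ℕ) (hε : 0 < ε) (hε₁ : 0 < ε₁)
    (hk : (fun n => (k n : ℝ)) =o[atTop] (fun n : ℕ => (n : ℝ) ^ (1 - ε)))
    (hkn : ∀ᶠ n : ℕ in atTop, (n : ℝ) ^ ε₁ < k n) :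
    kOBDDClass (fun n => ⌊(k n : ℝ) / (n : ℝ) ^ ε₁⌋₊) polylogWidth
      ⊂ kOBDDClass k polylogWidth := by
  refine kOBDDClass_floor_ssubset (fun n => ⌊√((n : ℝ) ^ ε₁) / 4⌋₊) _
    ?_ ?_ ?_ ?_ ?_ (eventually_one_le_rpow hε₁.le) (hkn.mono fun _ h => h.le) ?_
  · rintro w ⟨z, hw⟩
    exact ⟨fun n => w n + 2, ⟨z, natCast_add_const_isBigO hw (eventually_one_le_logb_pow z) 2⟩,
      fun n => ⟨Nat.le_add_right _ _, Nat.le_add_left _ _⟩⟩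
  · refine ⟨fun _ => 4, ⟨0, ?_⟩, fun _ => le_refl 4⟩
    simpa using isBigO_const_const (4 : ℝ) (one_ne_zero (α := ℝ)) (atTop : Filter ℕ)
  · rintro w ⟨z, hw⟩
    have h := hw.trans_isLittleO (logb_two_pow_isLittleO_rpow z (half_pos hε₁))
    filter_upwards [h.def (c := 1 / 4) (by norm_num)] with n hn
    rw [Real.norm_eq_abs, Real.norm_eq_abs, Nat.abs_cast, abs_of_nonneg (by positivity)] at hn
    refine Nat.le_floor ?_
    rw [Real.sqrt_eq_rpow, ← Real.rpow_mul (Nat.cast_nonneg _), mul_one_div]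
    linarith
  · filter_upwards [hkn, (logb_two_pow_isLittleO_rpow 1 hε₁).def (c := 1 / 8) (by norm_num)]
      with n h1 h2
    rw [Real.norm_eq_abs, Real.norm_eq_abs, pow_one,
      abs_of_nonneg (a := (n : ℝ) ^ ε₁) (by positivity)] at h2
    linarith [le_abs_self (Real.logb 2 (n : ℝ))]
  · refine two_mul_le_of_isLittleO hk ?_
    filter_upwards [eventually_ge_atTop 1] with n hn
    rw [abs_of_nonneg (by positivity)]
    exact (Real.rpow_le_rpow_of_exponent_le (by exact_mod_cast hn) (by linarith)).trans_eq
      (Real.rpow_one _)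
  · exact Eventually.of_forall fun n => mul_logb_floor_sqrt_le (by positivity)

theorem sublinear_kOBDDClass_ssubset (α : ℝ) (k : ℕ → ℕ) (hα : 0 < α) (hα' : α < 1 / 2)
    (hkn : ∀ᶠ n : ℕ in atTop, (n : ℝ) ^ α * Real.logb 2 n ^ 2 < k n)
    (hk : (fun n => (k n : ℝ)) =o[atTop] (fun n : ℕ => (n : ℝ) ^ (1 - α) / Real.logb 2 n)) :
    kOBDDClass (fun n => ⌊(k n : ℝ) / ((n : ℝ) ^ α * Real.logb 2 n ^ 2)⌋₊) (sublinearWidth α)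
      ⊂ kOBDDClass k (sublinearWidth α) := by
  have hL := tendsto_logb_two_natCast_atTop
  have hn1 := eventually_one_le_rpow hα.le
  -- Here `√D / 4` would be too small to exceed `n ^ α`. The factor `√(log₂ n)` absorbs every
  -- constant in `O(n ^ α)`, and `W log W ≤ n ^ α (log₂ n) ^ (3 / 2)` leaves another such factor to
  -- absorb the 16.
  refine kOBDDClass_floor_ssubset (fun n => ⌊(n : ℝ) ^ α * √(Real.logb 2 n)⌋₊) _
    ?_ ?_ ?_ ?_ ?_ ?_ (hkn.mono fun _ h => h.le) ?_
  · exact fun w hw => ⟨fun n => w n + 2, natCast_add_const_isBigO hw hn1 2,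
      fun n => ⟨Nat.le_add_right _ _, Nat.le_add_left _ _⟩⟩
  · refine ⟨fun _ => 4, ?_, fun _ => le_rfl⟩
    have h0 : (fun n : ℕ => (((fun _ => 0 : ℕ → ℕ) n : ℕ) : ℝ)) =O[atTop]
        fun n : ℕ => (n : ℝ) ^ α := by simpa using isBigO_zero _ _
    simpa [sublinearWidth] using natCast_add_const_isBigO h0 hn1 4
  · intro w hw
    obtain ⟨c, hc⟩ := hw.bound
    filter_upwards [hc, (Real.tendsto_sqrt_atTop.comp hL).eventually_ge_atTop c] with n h1 h2
    rw [Real.norm_eq_abs, Real.norm_eq_abs, Nat.abs_cast, abs_of_nonneg (by positivity)] at h1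
    refine Nat.le_floor (h1.trans ?_)
    rw [mul_comm]
    exact mul_le_mul_of_nonneg_left h2 (by positivity)
  · filter_upwards [hkn, hn1, hL.eventually_ge_atTop 8] with n h1 h2 h3
    nlinarith
  · refine two_mul_le_of_isLittleO hk ?_
    filter_upwards [eventually_ge_atTop 1, hL.eventually_ge_atTop 1] with n hn h1
    rw [abs_of_nonneg (by positivity)]
    refine (div_le_self (by positivity) h1).trans ?_
    exact (Real.rpow_le_rpow_of_exponent_le (by exact_mod_cast hn) (by linarith)).trans_eq
      (Real.rpow_one _)
  · filter_upwards [hn1, eventually_one_le_logb_pow 2] with n h1 h2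
    exact one_le_mul_of_one_le_of_one_le h1 h2
  · filter_upwards [eventually_ge_atTop 1, hn1, hL.eventually_ge_atTop (16 ^ 2),
      (logb_two_pow_isLittleO_rpow 1 one_pos).def (c := 1) one_pos] with n hn h1 h2 h3
    have hn' : (1 : ℝ) ≤ n := by exact_mod_cast hn
    have hL0 : 0 ≤ Real.logb 2 (n : ℝ) := by linarith
    have hs : 16 ≤ √(Real.logb 2 (n : ℝ)) := Real.le_sqrt_of_sq_le h2
    have hss := Real.mul_self_sqrt hL0
    rw [Real.norm_eq_abs, Real.norm_eq_abs, pow_one, Real.rpow_one, Nat.abs_cast, one_mul,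
      abs_of_nonneg hL0] at h3
    have hW : (⌊(n : ℝ) ^ α * √(Real.logb 2 n)⌋₊ : ℝ) ≤ (n : ℝ) ^ α * √(Real.logb 2 n) :=
      Nat.floor_le (by positivity)
    have hW1 : 1 ≤ ⌊(n : ℝ) ^ α * √(Real.logb 2 n)⌋₊ :=
      Nat.le_floor (by rw [Nat.cast_one]; nlinarith)
    -- `α < 1 / 2` enters here, giving `W ≤ n` and so `log W ≤ log n`.
    have hWn : (n : ℝ) ^ α * √(Real.logb 2 n) ≤ n :=
      calc (n : ℝ) ^ α * √(Real.logb 2 n) ≤ √n * √n := by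
            gcongr
            rw [Real.sqrt_eq_rpow]
            exact Real.rpow_le_rpow_of_exponent_le hn' hα'.le
        _ = n := Real.mul_self_sqrt (by positivity)
    have hlogW : Real.logb 2 ⌊(n : ℝ) ^ α * √(Real.logb 2 n)⌋₊ ≤ Real.logb 2 n :=
      Real.logb_le_logb_of_le one_lt_two (by exact_mod_cast hW1) (hW.trans hWn)
    have hlogW0 : 0 ≤ Real.logb 2 ⌊(n : ℝ) ^ α * √(Real.logb 2 n)⌋₊ :=
      Real.logb_nonneg one_lt_two (Nat.one_le_cast.2 hW1)
    calc 16 * ((⌊(n : ℝ) ^ α * √(Real.logb 2 n)⌋₊ : ℝ) *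
          Real.logb 2 ⌊(n : ℝ) ^ α * √(Real.logb 2 n)⌋₊)
        ≤ √(Real.logb 2 n) * (((n : ℝ) ^ α * √(Real.logb 2 n)) * Real.logb 2 n) := by
          gcongr
      _ = (n : ℝ) ^ α * (√(Real.logb 2 n) * √(Real.logb 2 n)) * Real.logb 2 n := by ring
      _ = (n : ℝ) ^ α * Real.logb 2 n ^ 2 := by rw [hss]; ring

theorem corollary3 :
    (∀ k : ℕ → ℕ,
      (fun n => (k n : ℝ)) =o[atTop] (fun n : ℕ => (n : ℝ) / Real.logb 2 n) →
      (fun n : ℕ => Real.logb 2 n) =o[atTop] (fun n => (k n : ℝ)) →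
      kOBDDClass (fun n => ⌊(k n : ℝ) / Real.logb 2 (Real.logb 2 n)⌋₊) constWidth
        ⊂ kOBDDClass k constWidth) ∧
    (∀ (ε ε₁ : ℝ) (k : ℕ → ℕ), 0 < ε → 0 < ε₁ →
      (fun n => (k n : ℝ)) =o[atTop] (fun n : ℕ => (n : ℝ) ^ (1 - ε)) →
      (∀ᶠ n : ℕ in atTop, (n : ℝ) ^ ε₁ < k n) →
      kOBDDClass (fun n => ⌊(k n : ℝ) / (n : ℝ) ^ ε₁⌋₊) polylogWidth
        ⊂ kOBDDClass k polylogWidth) ∧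
    (∀ (α ε : ℝ) (k : ℕ → ℕ), 0 < ε → 0 < α → α < 1 / 2 - ε →
      (∀ᶠ n : ℕ in atTop, (n : ℝ) ^ α * Real.logb 2 n ^ 2 < k n) →
      (fun n => (k n : ℝ)) =o[atTop] (fun n : ℕ => (n : ℝ) ^ (1 - α) / Real.logb 2 n) →
      kOBDDClass (fun n => ⌊(k n : ℝ) / ((n : ℝ) ^ α * Real.logb 2 n ^ 2)⌋₊) (sublinearWidth α)
        ⊂ kOBDDClass k (sublinearWidth α)) := by
  exact ⟨const_kOBDDClass_ssubset, polylog_kOBDDClass_ssubset, fun α ε k hε hα hαε =>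
    sublinear_kOBDDClass_ssubset α k hα (by linarith)⟩
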